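/- Cards of the EvenQuads-$2^n$ deck are the vectors of $\mathbb{Z}_2^n$, and four distinct cards form a quad if their sum is $0$. Distinct cards $a_1,\dots,a_\ell$ of such a deck realize the binary linear code of length $\ell$ consisting of the words $c\in\mathbb{Z}_2^\ell$ with an even number of ones and $\sum_i c_i a_i=0$. A quad code is a binary linear code in which all codewords have even weight and all nonzero codewords have weight at least $4$. A $4\times4$ array of $16$ distinct cards of one deck is a semimagic quad square if each row and each column forms a quad; a magic quad square if, in addition, both diagonals form quads; and a strongly magic quad square if any four different cells whose row coordinates are all the same, half and half, or all different, and whose column coordinates are all the same, half and half, or all different, contain cards that form a quad. Reading the square left to right and top to bottom, its $16$ cards realize a code of length $16$; the codes obtained in this way from the squares of a given type, over the decks of all sizes $2^n$, are the codes corresponding to this type. Theorem. All codes corresponding to semimagic, magic, or strongly magic quad squares are quad codes, and for each type the number of corresponding codes (as subspaces of $\mathbb{Z}_2^{16}$) of each dimension is $$\begin{array}{l|ccccc} \text{Dimension} & 7 & 8 & 9 & 10 & 11\\ \hline \text{Semimagic} & 1 & 159 & 2531 & 2823 & 112\\ \text{Magic} & 0 & 1 & 43 & 85 & 10\\ \text{Strongly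 magic} & 0 & 0 & 0 & 0 & 1\\ \hline \text{Deck size} & 256 & 128 & 64 & 32 & 16 \end{array}$$ and there are none in any other dimension. Moreover, the smallest size of an EvenQuads deck in which a corresponding code of dimension $k$ is realizable is $2^{15-k}$, as listed in the last row. -/

import Mathlib

namespace EvenQuads

/-- The cards of the EvenQuads deck of size `2 ^ n`: the vectors of `ℤ₂ⁿ`. -/
abbrev Card (n : ℕ) : Type := Fin n → ZMod 2

/-- Binary words of length `ℓ`. Their weight (the number of ones) is `hammingNorm`. -/
abbrev Word (ℓ : ℕ) : Type := Fin ℓ → ZMod 2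

/-- Linear binary codes of length `ℓ`. -/
abbrev LinearCode (ℓ : ℕ) : Type := Submodule (ZMod 2) (Word ℓ)

/-- Four cards form a quad: they are distinct and sum to zero. -/
def IsQuad {n : ℕ} (q : Fin 4 → Card n) : Prop :=
  Function.Injective q ∧ ∑ i, q i = 0

/-- A quad code: every codeword has even weight and every nonzero codeword has weight
at least `4`. -/
def IsQuadCode {ℓ : ℕ} (C : LinearCode ℓ) : Prop :=
  ∀ c ∈ C, Even (hammingNorm c) ∧ (c ≠ 0 → 4 ≤ hammingNorm c)

/-- The number of ones of a binary word is even exactly when its bits sum to zero. -/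
theorem even_hammingNorm_iff {ℓ : ℕ} (c : Word ℓ) :
    Even (hammingNorm c) ↔ ∑ i, c i = 0 := by
  have h : ∑ i, c i = (hammingNorm c : ZMod 2) := by
    unfold hammingNorm
    rw [Finset.card_filter]
    push_cast
    refine Finset.sum_congr rfl fun i _ => ?_
    have h2 : ∀ x : ZMod 2, x = 0 ∨ x = 1 := by decide
    rcases h2 (c i) with hx | hx <;> simp [hx]
  rw [h, ZMod.natCast_eq_zero_iff_even]

/-- The code of a sequence of cards: the words `c` with an even number of ones and
`c₁ a₁ + ⋯ + c_ℓ a_ℓ = 0`. -/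
def codeOf {n ℓ : ℕ} (a : Fin ℓ → Card n) : LinearCode ℓ where
  carrier := {c | Even (hammingNorm c) ∧ ∑ i, c i • a i = 0}
  zero_mem' := by simp
  add_mem' := by
    rintro c d ⟨hc, hc'⟩ ⟨hd, hd'⟩
    rw [even_hammingNorm_iff] at hc hd
    refine ⟨(even_hammingNorm_iff _).2 ?_, ?_⟩
    · simp [Finset.sum_add_distrib, hc, hd]
    · simp only [Pi.add_apply, add_smul, Finset.sum_add_distrib, hc', hd', add_zero]
  smul_mem' := by
    rintro r c ⟨hc, hc'⟩
    rw [even_hammingNorm_iff] at hc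
    refine ⟨(even_hammingNorm_iff _).2 ?_, ?_⟩
    · simp [← Finset.mul_sum, hc]
    · simp only [Pi.smul_apply, smul_assoc, ← Finset.smul_sum, hc', smul_zero]

/-- A sequence of (distinct) cards of a deck realizes the code `C`. -/
def Realizes {n ℓ : ℕ} (a : Fin ℓ → Card n) (C : LinearCode ℓ) : Prop :=
  Function.Injective a ∧ codeOf a = C

/-- The sizes of the decks in which the code `C` is realizable. -/
def realizingDeckSizes {ℓ : ℕ} (C : LinearCode ℓ) : Set ℕ :=
  {N | ∃ n : ℕ, N = Fintype.card (Card n) ∧ ∃ a : Fin ℓ → Card n, Realizes a C}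

/-- A 4-by-4 array of cards; `s i j` is the card in row `i` and column `j`. -/
abbrev Square (n : ℕ) : Type := Fin 4 → Fin 4 → Card n

/-- The 16 cards of a square, read left to right and top to bottom: the card in row `i` and
column `j` has position `4 * i + j` (counting from `0`). -/
def Square.cards {n : ℕ} (s : Square n) : Fin 16 → Card n :=
  fun p => s (finProdFinEquiv.symm p : Fin 4 × Fin 4).1 (finProdFinEquiv.symm p : Fin 4 × Fin 4).2

/-- Semimagic quad square: the 16 cards are distinct (they are taken from one deck), and each
row and each column forms a quad. -/
def IsSemimagic {n : ℕ} (s : Square n) : Prop :=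
  Function.Injective s.cards ∧
    (∀ i, IsQuad (fun j => s i j)) ∧ (∀ j, IsQuad (fun i => s i j))

/-- Magic quad square: each row, column, and diagonal forms a quad. -/
def IsMagic {n : ℕ} (s : Square n) : Prop :=
  IsSemimagic s ∧ IsQuad (fun i => s i i) ∧ IsQuad (fun i => s i i.rev)

/-- Four values are all the same, all different, or half and half. -/
def SameDiffOrHalf (v : Fin 4 → Fin 4) : Prop :=
  (∀ i j, v i = v j) ∨ Function.Injective v ∨
    ∀ i, (Finset.univ.filter fun j => v j = v i).card = 2

/-- Strongly magic quad square: any four different cells whose row coordinates, as well as whose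
column coordinates, are all the same, half and half, or all different, hold a quad. -/
def IsStronglyMagic {n : ℕ} (s : Square n) : Prop :=
  Function.Injective s.cards ∧
    ∀ p : Fin 4 → Fin 4 × Fin 4, Function.Injective p →
      SameDiffOrHalf (fun m => (p m).1) → SameDiffOrHalf (fun m => (p m).2) →
        IsQuad (fun m => s (p m).1 (p m).2)

/-- The three types of quad squares. -/
inductive SquareType
  | semimagic
  | magic
  | stronglyMagic

/-- The square `s` is a quad square of the given type. -/
def SquareType.Holds (t : SquareType) {n : ℕ} (s : Square n) : Prop :=
  match t with
  | .semimagic => IsSemimagic s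
  | .magic => IsMagic s
  | .stronglyMagic => IsStronglyMagic s

/-- The codes corresponding to quad squares of a type: the codes of the quad squares of this
type, over the decks of all sizes `2 ^ n`. -/
def squareCodes (t : SquareType) : Set (LinearCode 16) :=
  {C | ∃ (n : ℕ) (s : Square n), t.Holds s ∧ Realizes s.cards C}

/-- The table of the numbers of codes by type of square and dimension. -/
def codeTable : SquareType → ℕ → ℕ
  | .semimagic, 7 => 1
  | .semimagic, 8 => 159
  | .semimagic, 9 => 2531
  | .semimagic, 10 => 2823
  | .semimagic, 11 => 112
  | .magic, 8 => 1
  | .magic, 9 => 43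
  | .magic, 10 => 85
  | .magic, 11 => 10
  | .stronglyMagic, 11 => 1
  | _, _ => 0

end EvenQuads

/-!
A quad code is a code of even words with no word of weight two, and the code of distinct cards is
always one. Conversely a quad code `C` is realized by the images of the unit words in the quotient
of the space of words by `C` and one further unit word, a deck of size `2 ^ (ℓ - 1 - dim C)`; the
kernel of the map sending a word `c` to the pair of `∑ cᵢ aᵢ` and `∑ cᵢ` is the code, so no smaller
deck is enough (`IsQuadCode.isLeast_realizingDeckSizes`). Hence the codes of the squares of a type are
the quad codes that contain the words of the quadruples of cells required to hold quads
(`mem_squareCodes_iff`).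

All of these contain the rows and columns, which span a space of dimension `7`. The quotient by this
span is identified with `ℤ₂⁹` by the syndrome map, whose coordinates are the products of the
functions `1, x₁, x₂` of the row and the functions `1, y₁, y₂` of the column. In the quotient the
codes become the subspaces that avoid the syndromes of the words of odd weight and of weight two, and
that contain the syndromes of the required quads: nothing for semimagic squares, one vector for magic
squares, and a subspace of dimension `4` for strongly magic squares (`squareCodes_eq`).

These subspaces are counted by a search through their intersections with the coordinate subspaces
`initial m n`: the intersection with `initial m (n + 1)` is either the intersection with
`initial m n` or an extension of it by one of finitely many vectors. The search adds up `X ^ dim W` for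
a large `X` (`weightedCount_eq_sum_maskSubspaces`), so that the numbers of subspaces of each dimension
are the base `X` digits of the result (`ncard_maskSubspaces`), and it is evaluated in the kernel
(`weightedCount_quadMask`).
-/

namespace EvenQuads

/-! ### Binary vectors -/

theorem Word.add_self {m : ℕ} (x : Word m) : x + x = 0 :=
  funext fun i => CharTwo.add_self_eq_zero (x i)

theorem mem_sup_span_singleton {m : ℕ} {U : LinearCode m} {v x : Word m} :
    x ∈ U ⊔ Submodule.span (ZMod 2) {v} ↔ x ∈ U ∨ x + v ∈ U := by
  constructor
  · intro h
    obtain ⟨y, hy, z, hz, rfl⟩ := Submodule.mem_sup.1 h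
    obtain ⟨c, rfl⟩ := Submodule.mem_span_singleton.1 hz
    have h2 : ∀ c : ZMod 2, c = 0 ∨ c = 1 := by decide
    rcases h2 c with rfl | rfl
    · left; simpa using hy
    · right; simpa [add_assoc, Word.add_self] using hy
  · have hv : v ∈ U ⊔ Submodule.span (ZMod 2) {v} :=
      Submodule.mem_sup_right (Submodule.mem_span_singleton_self v)
    rintro (h | h)
    · exact Submodule.mem_sup_left h
    · have := add_mem (Submodule.mem_sup_left h) hv
      rwa [add_assoc, Word.add_self, add_zero] at this

/-- The vector of the `m` lowest binary digits of `a`. Bitwise exclusive or of numbers becomes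
addition of vectors, so numbers serve as vectors in computations. -/
def bits (m a : ℕ) : Word m := fun i => if a.testBit i then 1 else 0

theorem bits_zero (m : ℕ) : bits m 0 = 0 := by
  ext i; simp [bits]

theorem bits_xor (m a b : ℕ) : bits m (a ^^^ b) = bits m a + bits m b := by
  ext i
  simp only [bits, Nat.testBit_xor, Pi.add_apply]
  cases a.testBit i <;> cases b.testBit i <;> decide

theorem bits_injOn {m a b : ℕ} (ha : a < 2 ^ m) (hb : b < 2 ^ m) (h : bits m a = bits m b) :
    a = b := by
  refine Nat.eq_of_testBit_eq fun i => ?_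
  by_cases hi : i < m
  · have := congrFun h ⟨i, hi⟩
    simp only [bits] at this
    revert this
    cases a.testBit i <;> cases b.testBit i <;> simp
  · have hi' : 2 ^ m ≤ 2 ^ i := Nat.pow_le_pow_right (by norm_num) (not_lt.1 hi)
    rw [Nat.testBit_lt_two_pow (ha.trans_le hi'), Nat.testBit_lt_two_pow (hb.trans_le hi')]

theorem exists_bits {m : ℕ} (x : Word m) : ∃ a < 2 ^ m, bits m a = x := by
  have hinj : Function.Injective fun a : Fin (2 ^ m) => bits m a :=
    fun a b h => Fin.ext (bits_injOn a.2 b.2 h)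
  have hcard : Fintype.card (Fin (2 ^ m)) = Fintype.card (Word m) := by simp [ZMod.card]
  obtain ⟨a, ha⟩ := ((Fintype.bijective_iff_injective_and_card _).2 ⟨hinj, hcard⟩).2 x
  exact ⟨a, a.2, ha⟩

theorem bits_two_pow_apply {m n : ℕ} (i : Fin m) :
    bits m (2 ^ n) i = if n = i then 1 else 0 := by
  simp [bits, Nat.testBit_two_pow]

/-! ### Enumeration of the subspaces inside a set of vectors -/

/-- The vectors of length `m` that vanish from coordinate `n` on. -/
def initial (m n : ℕ) : LinearCode m where
  carrier := {x | ∀ i : Fin m, n ≤ i → x i = 0}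
  zero_mem' := by simp
  add_mem' := by
    intro x y hx hy i hi
    simp [hx i hi, hy i hi]
  smul_mem' := by
    intro c x hx i hi
    simp [hx i hi]

theorem initial_mono (m n : ℕ) : initial m n ≤ initial m (n + 1) :=
  fun _ hx i hi => hx i (by omega)

theorem bits_two_pow_mem_initial {m n : ℕ} : bits m (2 ^ n) ∈ initial m (n + 1) := by
  intro i hi
  rw [bits_two_pow_apply, if_neg (by omega)]

theorem mem_initial_or {m n : ℕ} (hn : n < m) {x : Word m} (hx : x ∈ initial m (n + 1)) :
    x ∈ initial m n ∨ x + bits m (2 ^ n) ∈ initial m n := by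
  have h2 : ∀ c : ZMod 2, c = 0 ∨ c = 1 := by decide
  have key : ∀ y ∈ initial m (n + 1), y ⟨n, hn⟩ = 0 → y ∈ initial m n := by
    intro y hy h0 i hi
    rcases eq_or_lt_of_le hi with h | h
    · rw [← h0]; congr 1; exact Fin.ext h.symm
    · exact hy i h
  rcases h2 (x ⟨n, hn⟩) with h | h
  · exact Or.inl (key x hx h)
  · refine Or.inr (key _ (add_mem hx bits_two_pow_mem_initial) ?_)
    rw [Pi.add_apply, h, bits_two_pow_apply, if_pos rfl]
    decide

theorem bits_two_pow_notMem_initial {m n : ℕ} (hn : n < m) : bits m (2 ^ n) ∉ initial m n := by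
  intro h
  have := h ⟨n, hn⟩ le_rfl
  rw [bits_two_pow_apply, if_pos rfl] at this
  exact one_ne_zero this

theorem add_bits_two_pow_notMem_initial {m n : ℕ} (hn : n < m) {x : Word m}
    (hx : x ∈ initial m n) : bits m (2 ^ n) + x ∉ initial m n := fun h =>
  bits_two_pow_notMem_initial hn ((Submodule.add_mem_iff_left _ hx).1 h)

theorem bits_mem_initial {m n a : ℕ} (ha : a < 2 ^ n) : bits m a ∈ initial m n := by
  intro i hi
  have : a < 2 ^ (i : ℕ) := ha.trans_le (Nat.pow_le_pow_right (by norm_num) hi)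
  simp [bits, Nat.testBit_lt_two_pow this]

theorem lt_of_bits_mem_initial {m n a : ℕ} (ha : a < 2 ^ m)
    (h : bits m a ∈ initial m n) : a < 2 ^ n := by
  refine Nat.lt_pow_two_of_testBit a fun i hi => ?_
  by_cases him : i < m
  · have := h ⟨i, him⟩ hi
    simpa [bits] using this
  · exact Nat.testBit_lt_two_pow (ha.trans_le (Nat.pow_le_pow_right (by norm_num) (not_lt.1 him)))

theorem initial_zero (m : ℕ) : initial m 0 = ⊥ :=
  eq_bot_iff.2 fun _ hx => (Submodule.mem_bot _).2 (funext fun i => hx i (Nat.zero_le _))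

theorem initial_succ {m n : ℕ} (hn : n < m) :
    initial m (n + 1) = initial m n ⊔ Submodule.span (ZMod 2) {bits m (2 ^ n)} := by
  refine le_antisymm (fun x hx => mem_sup_span_singleton.2 (mem_initial_or hn hx)) ?_
  exact sup_le (initial_mono m n)
    ((Submodule.span_singleton_le_iff_mem _ _).2 bits_two_pow_mem_initial)

theorem finrank_initial {m n : ℕ} (hn : n ≤ m) :
    Module.finrank (ZMod 2) (initial m n) = n := by
  induction n with
  | zero => rw [initial_zero, finrank_bot]
  | succ n ih =>
    rw [initial_succ hn, Submodule.finrank_sup_span_singleton (bits_two_pow_notMem_initial hn),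
      ih (Nat.le_of_succ_le hn)]

theorem initial_le_iff {m n : ℕ} (hn : n ≤ m) {U : LinearCode m} :
    initial m n ≤ U ↔ ∀ k < n, bits m (2 ^ k) ∈ U := by
  induction n with
  | zero => simp [initial_zero]
  | succ n ih =>
    rw [initial_succ hn, sup_le_iff, ih (Nat.le_of_succ_le hn),
      Submodule.span_singleton_le_iff_mem]
    exact ⟨fun h k hk => (Nat.lt_succ_iff_lt_or_eq.1 hk).elim (h.1 k) fun hk => hk ▸ h.2,
      fun h => ⟨fun k hk => h k (hk.trans n.lt_succ_self), h n n.lt_succ_self⟩⟩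

/-- The binary digits of `mask` are the indicator of a set of vectors, `a` standing for `bits m a`.
A subspace is inside the mask if all its vectors belong to this set. -/
def InsideMask (mask : ℕ) {m : ℕ} (W : LinearCode m) : Prop :=
  ∀ a < 2 ^ m, bits m a ∈ W → mask.testBit a = true

/-- The subspaces inside the mask that meet `initial m n` in `U`. -/
noncomputable def extensions (mask : ℕ) {m : ℕ} (n : ℕ) (U : LinearCode m) :
    Finset (LinearCode m) :=
  (Set.toFinite {W : LinearCode m | InsideMask mask W ∧ W ⊓ initial m n = U}).toFinset

theorem mem_extensions {mask m n : ℕ} {U W : LinearCode m} :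
    W ∈ extensions mask n U ↔ InsideMask mask W ∧ W ⊓ initial m n = U := by
  simp [extensions]

/-- Computes the sum of `X ^ dim W` over the subspaces `W` inside the mask that meet `initial m n`
in `U`, for a mask of vectors of `initial m (n + r)`. Here `r` is the first number after `X`, `bit` is
`2 ^ n`, `weight` is `X ^ dim U`, `elems` lists the vectors of `U`, and `reps` lists representatives
of the cosets of `U` in `initial m n`. The intersection of `W` with `initial m (n + 1)` is either `U`
or `U` extended by a vector `bit ^^^ w` with `w` a unique member of `reps`. -/
def weightedCount (mask X : ℕ) : ℕ → ℕ → ℕ → List ℕ → List ℕ → ℕ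
  | 0, _, weight, _, _ => weight
  | r + 1, bit, weight, elems, reps =>
    weightedCount mask X r (2 * bit) weight elems (reps ++ reps.map (bit ^^^ ·)) +
      (reps.map fun w =>
        bif elems.all (fun u => mask.testBit (bit ^^^ w ^^^ u)) then
          weightedCount mask X r (2 * bit) (weight * X)
            (elems ++ elems.map (bit ^^^ w ^^^ ·)) reps
        else 0).sum

/-- The lists `elems` and `reps` describe the subspace `U` of `initial m n`. -/
structure Describes {m : ℕ} (mask n : ℕ) (U : LinearCode m) (elems reps : List ℕ) : Prop where
  le_initial : U ≤ initial m n
  inside : InsideMask mask U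
  elems_lt : ∀ a ∈ elems, a < 2 ^ m
  mem_iff : ∀ x, x ∈ U ↔ ∃ a ∈ elems, bits m a = x
  reps_mem : ∀ w ∈ reps, bits m w ∈ initial m n
  reps_lt : ∀ w ∈ reps, w < 2 ^ m
  nodup : reps.Nodup
  exists_rep : ∀ x ∈ initial m n, ∃ w ∈ reps, x + bits m w ∈ U
  rep_unique : ∀ w ∈ reps, ∀ w' ∈ reps, bits m w + bits m w' ∈ U → w = w'

section Step

variable {m mask n : ℕ} {U : LinearCode m} {elems reps : List ℕ}

theorem sup_inf_initial {v : Word m} (hU : U ≤ initial m n) (hv : v ∉ initial m n) :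
    (U ⊔ Submodule.span (ZMod 2) {v}) ⊓ initial m n = U := by
  refine le_antisymm ?_ (le_inf le_sup_left hU)
  rintro x ⟨hx, hxn⟩
  rcases mem_sup_span_singleton.1 hx with h | h
  · exact h
  · exact absurd ((Submodule.add_mem_iff_right _ hxn).1 (hU h)) hv

/-- The description stays valid when the next coordinate is allowed but not used. -/
theorem Describes.skip (hn : n < m) (h : Describes mask n U elems reps) :
    Describes mask (n + 1) U elems (reps ++ reps.map (2 ^ n ^^^ ·)) where
  le_initial := h.le_initial.trans (initial_mono m n)
  inside := h.inside
  elems_lt := h.elems_lt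
  mem_iff := h.mem_iff
  reps_mem := by
    intro w hw
    rcases List.mem_append.1 hw with hw | hw
    · exact initial_mono m n (h.reps_mem w hw)
    · obtain ⟨v, hv, rfl⟩ := List.mem_map.1 hw
      rw [bits_xor]
      exact add_mem bits_two_pow_mem_initial (initial_mono m n (h.reps_mem v hv))
  reps_lt := by
    intro w hw
    rcases List.mem_append.1 hw with hw | hw
    · exact h.reps_lt w hw
    · obtain ⟨v, hv, rfl⟩ := List.mem_map.1 hw
      exact Nat.xor_lt_two_pow (Nat.pow_lt_pow_right (by norm_num) hn) (h.reps_lt v hv)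
  nodup := by
    refine List.nodup_append.2 ⟨h.nodup, h.nodup.map fun a b hab => Nat.xor_right_injective hab, ?_⟩
    rintro a ha b hb rfl
    obtain ⟨w, hw, rfl⟩ := List.mem_map.1 hb
    have := h.reps_mem _ ha
    rw [bits_xor] at this
    exact add_bits_two_pow_notMem_initial hn (h.reps_mem w hw) this
  exists_rep := by
    intro x hx
    rcases mem_initial_or hn hx with hx | hx
    · obtain ⟨w, hw, hxw⟩ := h.exists_rep x hx
      exact ⟨w, List.mem_append_left _ hw, hxw⟩
    · obtain ⟨w, hw, hxw⟩ := h.exists_rep _ hx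
      refine ⟨2 ^ n ^^^ w, List.mem_append_right _ (List.mem_map_of_mem hw), ?_⟩
      rwa [bits_xor, ← add_assoc]
  rep_unique := by
    intro w hw w' hw' hU
    rcases List.mem_append.1 hw with hw | hw <;> rcases List.mem_append.1 hw' with hw' | hw'
    · exact h.rep_unique w hw w' hw' hU
    · obtain ⟨v, hv, rfl⟩ := List.mem_map.1 hw'
      rw [bits_xor, add_left_comm] at hU
      exact absurd (h.le_initial hU) (add_bits_two_pow_notMem_initial hn
        (add_mem (h.reps_mem w hw) (h.reps_mem v hv)))
    · obtain ⟨v, hv, rfl⟩ := List.mem_map.1 hw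
      rw [bits_xor, add_assoc] at hU
      exact absurd (h.le_initial hU) (add_bits_two_pow_notMem_initial hn
        (add_mem (h.reps_mem v hv) (h.reps_mem w' hw')))
    · obtain ⟨v, hv, rfl⟩ := List.mem_map.1 hw
      obtain ⟨v', hv', rfl⟩ := List.mem_map.1 hw'
      rw [bits_xor, bits_xor, add_add_add_comm, Word.add_self, zero_add] at hU
      rw [h.rep_unique v hv v' hv' hU]

theorem Describes.notMem (hn : n < m) (h : Describes mask n U elems reps) {w : ℕ}
    (hw : w ∈ reps) : bits m (2 ^ n ^^^ w) ∉ initial m n := by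
  rw [bits_xor]
  exact add_bits_two_pow_notMem_initial hn (h.reps_mem w hw)

/-- The description of the subspace extended by `2 ^ n ^^^ w`: the coset representatives stay the
same. -/
theorem Describes.extend (hn : n < m) (h : Describes mask n U elems reps) {w : ℕ} (hw : w ∈ reps)
    (hmask : ∀ u ∈ elems, mask.testBit (2 ^ n ^^^ w ^^^ u) = true) :
    Describes mask (n + 1) (U ⊔ Submodule.span (ZMod 2) {bits m (2 ^ n ^^^ w)})
      (elems ++ elems.map (2 ^ n ^^^ w ^^^ ·)) reps := by
  have hv := h.notMem hn hw
  have hlt : 2 ^ n ^^^ w < 2 ^ m :=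
    Nat.xor_lt_two_pow (Nat.pow_lt_pow_right (by norm_num) hn) (h.reps_lt w hw)
  have hvn : bits m (2 ^ n ^^^ w) ∈ initial m (n + 1) := by
    rw [bits_xor]
    exact add_mem bits_two_pow_mem_initial (initial_mono m n (h.reps_mem w hw))
  have hle : U ⊔ Submodule.span (ZMod 2) {bits m (2 ^ n ^^^ w)} ≤ initial m (n + 1) :=
    sup_le (h.le_initial.trans (initial_mono m n)) ((Submodule.span_singleton_le_iff_mem _ _).2 hvn)
  have hmem : ∀ x, x ∈ U ⊔ Submodule.span (ZMod 2) {bits m (2 ^ n ^^^ w)} ↔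
      ∃ a ∈ elems ++ elems.map (2 ^ n ^^^ w ^^^ ·), bits m a = x := by
    intro x
    rw [mem_sup_span_singleton, h.mem_iff, h.mem_iff]
    constructor
    · rintro (⟨a, ha, rfl⟩ | ⟨a, ha, hax⟩)
      · exact ⟨a, List.mem_append_left _ ha, rfl⟩
      · refine ⟨_, List.mem_append_right _ (List.mem_map_of_mem ha), ?_⟩
        rw [bits_xor _ (2 ^ n ^^^ w), hax, add_left_comm, Word.add_self, add_zero]
    · rintro ⟨a, ha, rfl⟩
      rcases List.mem_append.1 ha with ha | ha
      · exact Or.inl ⟨a, ha, rfl⟩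
      · obtain ⟨u, hu, rfl⟩ := List.mem_map.1 ha
        refine Or.inr ⟨u, hu, ?_⟩
        rw [bits_xor _ (2 ^ n ^^^ w), add_right_comm, Word.add_self, zero_add]
  have helt : ∀ a ∈ elems ++ elems.map (2 ^ n ^^^ w ^^^ ·), a < 2 ^ m := by
    intro a ha
    rcases List.mem_append.1 ha with ha | ha
    · exact h.elems_lt a ha
    · obtain ⟨u, hu, rfl⟩ := List.mem_map.1 ha
      exact Nat.xor_lt_two_pow hlt (h.elems_lt u hu)
  refine ⟨hle, ?_, helt, hmem, fun w' hw' => initial_mono m n (h.reps_mem w' hw'), h.reps_lt,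
    h.nodup, ?_, ?_⟩
  · intro a ha haU
    obtain ⟨b, hb, hba⟩ := (hmem _).1 haU
    obtain rfl := bits_injOn (helt b hb) ha hba
    rcases List.mem_append.1 hb with hb | hb
    · exact h.inside b ha ((h.mem_iff _).2 ⟨b, hb, rfl⟩)
    · obtain ⟨u, hu, rfl⟩ := List.mem_map.1 hb
      exact hmask u hu
  · intro x hx
    have hx' : x ∈ initial m n ∨ x + bits m (2 ^ n ^^^ w) ∈ initial m n := by
      refine (mem_initial_or hn hx).imp_right fun hx => ?_
      rw [bits_xor, ← add_assoc]
      exact add_mem hx (h.reps_mem w hw)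
    rcases hx' with hx | hx
    · obtain ⟨w', hw', hxw⟩ := h.exists_rep x hx
      exact ⟨w', hw', Submodule.mem_sup_left hxw⟩
    · obtain ⟨w', hw', hxw⟩ := h.exists_rep _ hx
      refine ⟨w', hw', mem_sup_span_singleton.2 (Or.inr ?_)⟩
      rwa [add_right_comm]
  · intro w₁ hw₁ w₂ hw₂ hU
    refine h.rep_unique w₁ hw₁ w₂ hw₂ ?_
    rw [← sup_inf_initial h.le_initial hv]
    exact ⟨hU, add_mem (h.reps_mem w₁ hw₁) (h.reps_mem w₂ hw₂)⟩

/-- A subspace that meets `initial m n` in `U` meets `initial m (n + 1)` either in `U`, or in `U`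
extended by `2 ^ n ^^^ w` for a unique coset representative `w`. -/
theorem extensions_split (hn : n < m) (h : Describes mask n U elems reps)
    (f : LinearCode m → ℕ) :
    ∑ W ∈ extensions mask n U, f W = ∑ W ∈ extensions mask (n + 1) U, f W +
      (reps.map fun w => ∑ W ∈ extensions mask (n + 1)
        (U ⊔ Submodule.span (ZMod 2) {bits m (2 ^ n ^^^ w)}), f W).sum := by
  classical
  have hinf : ∀ W : LinearCode m, W ⊓ initial m (n + 1) ⊓ initial m n = W ⊓ initial m n := by
    intro W
    rw [inf_assoc, inf_eq_right.2 (initial_mono m n)]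
  rw [← List.sum_toFinset _ h.nodup, ← Finset.sum_biUnion, ← Finset.sum_union]
  · refine Finset.sum_congr ?_ fun _ _ => rfl
    ext W
    simp only [Finset.mem_union, Finset.mem_biUnion, List.mem_toFinset, mem_extensions]
    constructor
    · rintro ⟨hm, hU⟩
      by_cases hW : W ⊓ initial m (n + 1) = U
      · exact Or.inl ⟨hm, hW⟩
      · right
        have hle : U ≤ W ⊓ initial m (n + 1) := by
          rw [← hU]; exact inf_le_inf_left _ (initial_mono m n)
        obtain ⟨x, ⟨hxW, hxn⟩, hxU⟩ := Set.not_subset.1 fun hsub => hW (le_antisymm hsub hle)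
        have hx : x + bits m (2 ^ n) ∈ initial m n := by
          refine (mem_initial_or hn hxn).resolve_left fun hx => hxU ?_
          rw [← hU]; exact ⟨hxW, hx⟩
        obtain ⟨w, hw, hxw⟩ := h.exists_rep _ hx
        have hv : bits m (2 ^ n ^^^ w) ∈ W := by
          rw [add_assoc, ← bits_xor, ← hU] at hxw
          exact (Submodule.add_mem_iff_right _ hxW).1 hxw.1
        have hvn : bits m (2 ^ n ^^^ w) ∈ initial m (n + 1) := by
          rw [bits_xor]
          exact add_mem bits_two_pow_mem_initial (initial_mono m n (h.reps_mem w hw))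
        refine ⟨w, hw, hm, le_antisymm ?_ (sup_le hle
          ((Submodule.span_singleton_le_iff_mem _ _).2 ⟨hv, hvn⟩))⟩
        rintro y ⟨hyW, hyn⟩
        refine mem_sup_span_singleton.2 ((mem_initial_or hn hyn).imp (fun hy => ?_) fun hy => ?_)
        · rw [← hU]; exact ⟨hyW, hy⟩
        · rw [← hU]
          refine ⟨add_mem hyW hv, ?_⟩
          rw [bits_xor, ← add_assoc]
          exact add_mem hy (h.reps_mem w hw)
    · rintro (⟨hm, hU⟩ | ⟨w, hw, hm, hU⟩)
      · refine ⟨hm, ?_⟩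
        rw [← hinf, hU, inf_eq_left.2 h.le_initial]
      · refine ⟨hm, ?_⟩
        rw [← hinf, hU, sup_inf_initial h.le_initial (h.notMem hn hw)]
  · rw [Finset.disjoint_left]
    intro W hW hW'
    simp only [Finset.mem_biUnion, List.mem_toFinset, mem_extensions] at hW hW'
    obtain ⟨w, hw, -, hU⟩ := hW'
    rw [hW.2] at hU
    refine h.notMem hn hw (h.le_initial ?_)
    rw [hU]
    exact Submodule.mem_sup_right (Submodule.mem_span_singleton_self _)
  · intro w hw w' hw' hne
    refine Finset.disjoint_left.2 fun W hW hW' => hne ?_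
    rw [mem_extensions] at hW hW'
    have hw := List.mem_toFinset.1 hw
    have hw' := List.mem_toFinset.1 hw'
    refine h.rep_unique w hw w' hw' ?_
    rw [← sup_inf_initial h.le_initial (h.notMem hn hw)]
    refine ⟨?_, add_mem (h.reps_mem w hw) (h.reps_mem w' hw')⟩
    have h1 := Submodule.mem_sup_right (S := U)
      (Submodule.mem_span_singleton_self (R := ZMod 2) (bits m (2 ^ n ^^^ w)))
    have h2 := Submodule.mem_sup_right (S := U)
      (Submodule.mem_span_singleton_self (R := ZMod 2) (bits m (2 ^ n ^^^ w')))
    rw [← hW'.2, hW.2] at h2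
    have hadd : bits m (2 ^ n ^^^ w) + bits m (2 ^ n ^^^ w') = bits m w + bits m w' := by
      rw [bits_xor, bits_xor, add_add_add_comm, Word.add_self, zero_add]
    rw [← hadd]
    exact add_mem h1 h2

end Step

theorem InsideMask.le_initial {mask m k : ℕ} (hmask : ∀ a, mask.testBit a = true → a < 2 ^ k)
    {W : LinearCode m} (hW : InsideMask mask W) : W ≤ initial m k := by
  intro x hx
  obtain ⟨a, ha, rfl⟩ := exists_bits x
  exact bits_mem_initial (hmask a (hW a ha hx))

theorem weightedCount_eq_sum {mask m k : ℕ} (hmask : ∀ a, mask.testBit a = true → a < 2 ^ k)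
    (hk : k ≤ m) (X r : ℕ) : ∀ (n : ℕ) (U : LinearCode m) (elems reps : List ℕ), r + n = k →
      Describes mask n U elems reps →
      weightedCount mask X r (2 ^ n) (X ^ Module.finrank (ZMod 2) U) elems reps =
        ∑ W ∈ extensions mask n U, X ^ Module.finrank (ZMod 2) W := by
  induction r with
  | zero =>
    intro n U elems reps hn h
    obtain rfl : n = k := by omega
    have : extensions mask n U = {U} := by
      ext W
      rw [mem_extensions, Finset.mem_singleton]
      constructor
      · rintro ⟨hW, rfl⟩
        exact (inf_eq_left.2 (hW.le_initial hmask)).symm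
      · rintro rfl
        exact ⟨h.inside, inf_eq_left.2 h.le_initial⟩
    rw [weightedCount, this, Finset.sum_singleton]
  | succ r ih =>
    intro n U elems reps hn h
    have hlt : n < m := by omega
    rw [weightedCount, extensions_split hlt h, ← pow_succ',
      ih (n + 1) U _ _ (by omega) (h.skip hlt)]
    congr 2
    refine List.map_congr_left fun w hw => ?_
    have hv : bits m (2 ^ n ^^^ w) ∉ U := fun hU => h.notMem hlt hw (h.le_initial hU)
    by_cases hall : ∀ u ∈ elems, mask.testBit (2 ^ n ^^^ w ^^^ u) = true
    · rw [List.all_eq_true.2 hall, cond_true, ← ih (n + 1) _ _ _ (by omega) (h.extend hlt hw hall),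
        Submodule.finrank_sup_span_singleton hv, pow_succ X]
    · rw [Bool.eq_false_iff.2 (fun hb => hall (List.all_eq_true.1 hb)), cond_false]
      refine (Finset.sum_eq_zero fun W hW => absurd (fun u hu => ?_) hall).symm
      obtain ⟨hm, hWU⟩ := mem_extensions.1 hW
      refine hm _ (Nat.xor_lt_two_pow (Nat.xor_lt_two_pow (Nat.pow_lt_pow_right (by norm_num) hlt)
        (h.reps_lt w hw)) (h.elems_lt u hu)) ?_
      refine (inf_le_left : W ⊓ initial m (n + 1) ≤ W) ?_
      rw [hWU, bits_xor _ (2 ^ n ^^^ w), mem_sup_span_singleton]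
      right
      rw [add_right_comm, Word.add_self, zero_add]
      exact (h.mem_iff _).2 ⟨u, hu, rfl⟩

/-- The subspaces inside the mask that contain `initial m n`. -/
def maskSubspaces (mask m n : ℕ) : Set (LinearCode m) :=
  {W | InsideMask mask W ∧ initial m n ≤ W}

theorem weightedCount_eq_sum_maskSubspaces {mask m k n : ℕ}
    (hmask : ∀ a, mask.testBit a = true → a < 2 ^ k) (hk : k ≤ m) (hn : n ≤ k)
    (hinit : ∀ a < 2 ^ n, mask.testBit a = true) (X : ℕ) :
    weightedCount mask X (k - n) (2 ^ n) (X ^ n) (List.range (2 ^ n)) [0] =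
      ∑ W ∈ (Set.toFinite (maskSubspaces mask m n)).toFinset, X ^ Module.finrank (ZMod 2) W := by
  have hlt : 2 ^ n ≤ 2 ^ m := Nat.pow_le_pow_right (by norm_num) (hn.trans hk)
  have hdesc : Describes mask n (initial m n) (List.range (2 ^ n)) [0] := by
    refine ⟨le_rfl, ?_, ?_, ?_, ?_, by simp, by simp, ?_, by simp⟩
    · intro a ha h
      exact hinit a (lt_of_bits_mem_initial ha h)
    · intro a ha
      exact (List.mem_range.1 ha).trans_le hlt
    · intro x
      constructor
      · intro hx
        obtain ⟨a, ha, rfl⟩ := exists_bits x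
        exact ⟨a, List.mem_range.2 (lt_of_bits_mem_initial ha hx), rfl⟩
      · rintro ⟨a, ha, rfl⟩
        exact bits_mem_initial (List.mem_range.1 ha)
    · simp [bits_zero]
    · intro x hx
      exact ⟨0, by simp, by simpa [bits_zero] using hx⟩
  have := weightedCount_eq_sum hmask hk X (k - n) n _ _ _ (by omega) hdesc
  rw [finrank_initial (hn.trans hk)] at this
  rw [this]
  refine Finset.sum_congr ?_ fun _ _ => rfl
  ext W
  simp [mem_extensions, maskSubspaces]

theorem ofDigits_ofFn (X : ℕ) : ∀ (k : ℕ) (a : Fin k → ℕ),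
    Nat.ofDigits X (List.ofFn a) = ∑ d : Fin k, a d * X ^ (d : ℕ) := by
  intro k
  induction k with
  | zero => simp
  | succ k ih =>
    intro a
    rw [List.ofFn_succ, Nat.ofDigits_cons, ih, Fin.sum_univ_succ, Finset.mul_sum]
    simp only [Fin.val_zero, pow_zero, mul_one, Fin.val_succ, pow_succ]
    congr 1
    exact Finset.sum_congr rfl fun d _ => by ring

/-- If `X` exceeds the number of terms, the numbers of equal terms in a sum of powers of `X` are its
base `X` digits. -/
theorem card_filter_eq_of_sum_pow_eq {α : Type*} (s : Finset α) (f : α → ℕ) (X k : ℕ)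
    (hX : 1 < X) (hs : s.card < X) (hf : ∀ x ∈ s, f x < k) (a : ℕ → ℕ) (ha : ∀ d, a d < X)
    (hsum : ∑ x ∈ s, X ^ f x = ∑ d : Fin k, a d * X ^ (d : ℕ)) {d : ℕ} (hd : d < k) :
    (s.filter fun x => f x = d).card = a d := by
  have h1 : ∑ x ∈ s, X ^ f x = ∑ d : Fin k, (s.filter fun x => f x = d).card * X ^ (d : ℕ) := by
    rw [Fin.sum_univ_eq_sum_range (fun d => (s.filter fun x => f x = d).card * X ^ d) k,
      ← Finset.sum_fiberwise_of_maps_to (g := f) (t := Finset.range k)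
        (fun x hx => Finset.mem_range.2 (hf x hx))]
    refine Finset.sum_congr rfl fun d _ => ?_
    rw [Finset.sum_congr rfl fun x hx => by rw [(Finset.mem_filter.1 hx).2], Finset.sum_const,
      smul_eq_mul]
  rw [h1, ← ofDigits_ofFn X k fun d => (s.filter fun x => f x = d).card,
    ← ofDigits_ofFn X k fun d => a d] at hsum
  have := Nat.ofDigits_inj_of_len_eq hX (by simp) ?_ ?_ hsum
  · exact congrFun (List.ofFn_injective this) ⟨d, hd⟩
  · intro l hl
    obtain ⟨d, rfl⟩ := (List.mem_ofFn' _ _).1 hl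
    exact (Finset.card_filter_le _ _).trans_lt hs
  · intro l hl
    obtain ⟨d, rfl⟩ := (List.mem_ofFn' _ _).1 hl
    exact ha d

/-- A crude bound, enough to separate the base `2 ^ (2 ^ m + 1)` digits. -/
theorem card_linearCode_lt {m : ℕ} (s : Finset (LinearCode m)) : s.card < 2 ^ (2 ^ m + 1) := by
  classical
  have h : (s.image fun W : LinearCode m => (W : Set (Word m))).card = s.card :=
    Finset.card_image_of_injective _ SetLike.coe_injective
  have h2 := Finset.card_le_univ (s.image fun W : LinearCode m => (W : Set (Word m)))
  rw [h, Fintype.card_set] at h2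
  have h3 : Fintype.card (Word m) = 2 ^ m := by simp [ZMod.card]
  rw [h3] at h2
  exact h2.trans_lt (Nat.pow_lt_pow_right (by norm_num) (by omega))

/-- The numbers of subspaces of each dimension are read off from a value of `weightedCount`. -/
theorem ncard_maskSubspaces {mask m k n : ℕ} (hmask : ∀ a, mask.testBit a = true → a < 2 ^ k)
    (hk : k ≤ m) (hn : n ≤ k) (hinit : ∀ a < 2 ^ n, mask.testBit a = true) (a : ℕ → ℕ)
    (ha : ∀ d, a d < 2 ^ (2 ^ m + 1))
    (hcount : weightedCount mask (2 ^ (2 ^ m + 1)) (k - n) (2 ^ n) ((2 ^ (2 ^ m + 1)) ^ n)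
      (List.range (2 ^ n)) [0] = ∑ d : Fin (m + 1), a d * (2 ^ (2 ^ m + 1)) ^ (d : ℕ))
    {d : ℕ} (hd : d ≤ m) :
    {W ∈ maskSubspaces mask m n | Module.finrank (ZMod 2) W = d}.ncard = a d := by
  rw [weightedCount_eq_sum_maskSubspaces hmask hk hn hinit] at hcount
  have := card_filter_eq_of_sum_pow_eq _ _ _ (m + 1) (Nat.one_lt_two_pow (Nat.succ_ne_zero _))
    (card_linearCode_lt _) (fun W _ => Nat.lt_succ_of_le
      ((Submodule.finrank_le W).trans_eq (by simp))) a ha hcount (Nat.lt_succ_of_le hd)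
  rw [← this, ← Set.ncard_coe_finset]
  congr 1
  ext W
  simp

/-! ### Quad codes and their realizations -/

theorem hammingNorm_single_add_single {ℓ : ℕ} {i j : Fin ℓ} (hij : i ≠ j) :
    hammingNorm (Pi.single i 1 + Pi.single j 1 : Word ℓ) = 2 := by
  have : (Finset.univ.filter fun k => (Pi.single i 1 + Pi.single j 1 : Word ℓ) k ≠ 0) = {i, j} := by
    ext k
    by_cases hi : k = i
    · subst hi; simp [hij]
    · by_cases hj : k = j
      · subst hj; simp [hi]
      · simp [hi, hj]
  rw [hammingNorm, this, Finset.card_pair hij]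

theorem eq_single_add_single {ℓ : ℕ} {c : Word ℓ} (hc : hammingNorm c = 2) :
    ∃ i j, i ≠ j ∧ c = Pi.single i 1 + Pi.single j 1 := by
  obtain ⟨i, j, hij, h⟩ := Finset.card_eq_two.1 hc
  refine ⟨i, j, hij, funext fun k => ?_⟩
  have h2 : ∀ x : ZMod 2, x = 0 ∨ x = 1 := by decide
  have hk : c k ≠ 0 ↔ k = i ∨ k = j := by
    have := congrArg (k ∈ ·) h
    simpa using this
  by_cases hi : k = i
  · subst hi; simpa [hij] using (h2 (c k)).resolve_left (hk.2 (Or.inl rfl))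
  · by_cases hj : k = j
    · subst hj; simpa [hi] using (h2 (c k)).resolve_left (hk.2 (Or.inr rfl))
    · simpa [hi, hj] using hk

theorem isQuadCode_iff {ℓ : ℕ} {C : LinearCode ℓ} :
    IsQuadCode C ↔ (∀ c ∈ C, ∑ i, c i = 0) ∧
      ∀ i j, i ≠ j → (Pi.single i 1 + Pi.single j 1 : Word ℓ) ∉ C := by
  constructor
  · refine fun h => ⟨fun c hc => (even_hammingNorm_iff c).1 (h c hc).1, fun i j hij hmem => ?_⟩
    have hw := hammingNorm_single_add_single hij
    have := (h _ hmem).2 (by rw [← hammingNorm_pos_iff, hw]; norm_num)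
    omega
  · rintro ⟨h, h2⟩ c hc
    have heven := (even_hammingNorm_iff c).2 (h c hc)
    refine ⟨heven, fun h0 => ?_⟩
    have hpos := hammingNorm_pos_iff.2 h0
    have hne : hammingNorm c ≠ 2 := by
      intro hw
      obtain ⟨i, j, hij, rfl⟩ := eq_single_add_single hw
      exact h2 i j hij hc
    obtain ⟨k, hk⟩ := heven
    omega

theorem mem_codeOf {n ℓ : ℕ} {a : Fin ℓ → Card n} {c : Word ℓ} :
    c ∈ codeOf a ↔ ∑ i, c i = 0 ∧ ∑ i, c i • a i = 0 := by
  rw [← even_hammingNorm_iff]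
  exact Iff.rfl

theorem sum_single_add_single {ℓ : ℕ} (i j : Fin ℓ) :
    ∑ k, (Pi.single i 1 + Pi.single j 1 : Word ℓ) k = 0 := by
  simp only [Pi.add_apply, Finset.sum_add_distrib, Finset.sum_pi_single', Finset.mem_univ, if_true]
  decide

theorem sum_smul_single_add_single {n ℓ : ℕ} (a : Fin ℓ → Card n) (i j : Fin ℓ) :
    ∑ k, (Pi.single i 1 + Pi.single j 1 : Word ℓ) k • a k = a i + a j := by
  simp [add_smul, Finset.sum_add_distrib, Pi.single_apply]

theorem Realizes.isQuadCode {n ℓ : ℕ} {a : Fin ℓ → Card n} {C : LinearCode ℓ}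
    (h : Realizes a C) : IsQuadCode C := by
  obtain ⟨hinj, rfl⟩ := h
  refine isQuadCode_iff.2 ⟨fun c hc => (mem_codeOf.1 hc).1, fun i j hij hmem => hij (hinj ?_)⟩
  have := (mem_codeOf.1 hmem).2
  rw [sum_smul_single_add_single] at this
  rw [← add_zero (a i), ← Word.add_self (a j), ← add_assoc, this, zero_add]

/-- The cards are the images of the unit words in the quotient by `C` and one more unit word: its
even words are the ones of `C`. -/
theorem IsQuadCode.exists_realizes {ℓ : ℕ} {C : LinearCode (ℓ + 1)} (hC : IsQuadCode C) :
    ∃ a : Fin (ℓ + 1) → Card (ℓ - Module.finrank (ZMod 2) C), Realizes a C := by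
  obtain ⟨heven, hpair⟩ := isQuadCode_iff.1 hC
  set e : Word (ℓ + 1) := Pi.single 0 1 with he
  have hesum : ∑ i, e i = 1 := by simp [he]
  have heC : e ∉ C := fun h => one_ne_zero (hesum.symm.trans (heven e h))
  set D := C ⊔ Submodule.span (ZMod 2) {e} with hD
  have hDfin : Module.finrank (ZMod 2) D = Module.finrank (ZMod 2) C + 1 :=
    Submodule.finrank_sup_span_singleton heC
  have hQ : Module.finrank (ZMod 2) (Word (ℓ + 1) ⧸ D) =
      Module.finrank (ZMod 2) (Card (ℓ - Module.finrank (ZMod 2) C)) := by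
    have := D.finrank_quotient_add_finrank
    rw [Module.finrank_fin_fun] at this ⊢
    omega
  set f := (LinearEquiv.ofFinrankEq _ _ hQ).toLinearMap ∘ₗ D.mkQ with hf
  have hker : ∀ c, f c = 0 ↔ c ∈ D := fun c => by simp [hf]
  have hmem : ∀ c, ∑ i, c i = 0 → (f c = 0 ↔ c ∈ C) := by
    intro c hc
    rw [hker, hD, mem_sup_span_singleton]
    refine ⟨fun h => h.resolve_right fun h => ?_, Or.inl⟩
    have := heven _ h
    simp only [Pi.add_apply, Finset.sum_add_distrib, hc, hesum, zero_add] at this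
    exact one_ne_zero this
  have hsum : ∀ c : Word (ℓ + 1), ∑ i, c i • f (Pi.single i 1) = f c := by
    intro c
    conv_rhs => rw [pi_eq_sum_univ' c]
    simp [map_sum, map_smul]
  refine ⟨fun i => f (Pi.single i 1), fun i j hij => ?_, ?_⟩
  · by_contra hne
    refine hpair i j hne ((hmem _ (sum_single_add_single i j)).1 ?_)
    rw [map_add]
    simp only at hij
    rw [hij, Word.add_self]
  · ext c
    rw [mem_codeOf, hsum]
    exact ⟨fun h => (hmem c h.1).1 h.2, fun h => ⟨heven c h, (hmem c (heven c h)).2 h⟩⟩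

theorem Realizes.le_finrank_add {n ℓ : ℕ} {a : Fin ℓ → Card n} {C : LinearCode ℓ}
    (h : Realizes a C) : ℓ ≤ Module.finrank (ZMod 2) C + (n + 1) := by
  obtain ⟨-, rfl⟩ := h
  let g : Word ℓ →ₗ[ZMod 2] ZMod 2 × Card n :=
    (Fintype.linearCombination (ZMod 2) fun _ => (1 : ZMod 2)).prod
      (Fintype.linearCombination (ZMod 2) a)
  have hker : LinearMap.ker g = codeOf a := by
    ext c
    rw [LinearMap.mem_ker, mem_codeOf]
    simp [g, Fintype.linearCombination_apply]
  have h1 := g.finrank_range_add_finrank_ker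
  have h2 := Submodule.finrank_le (LinearMap.range g)
  rw [hker, Module.finrank_fin_fun] at h1
  rw [Module.finrank_prod, Module.finrank_self, Module.finrank_fin_fun] at h2
  omega

theorem IsQuadCode.isLeast_realizingDeckSizes {ℓ : ℕ} {C : LinearCode (ℓ + 1)}
    (hC : IsQuadCode C) :
    IsLeast (realizingDeckSizes C) (2 ^ (ℓ - Module.finrank (ZMod 2) C)) := by
  have hcard : ∀ n, Fintype.card (Card n) = 2 ^ n := fun n => by simp [ZMod.card]
  constructor
  · exact ⟨_, (hcard _).symm, hC.exists_realizes⟩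
  · rintro N ⟨n, rfl, a, ha⟩
    rw [hcard]
    have := ha.le_finrank_add
    exact Nat.pow_le_pow_right (by norm_num) (by omega)

/-! ### The codes of quad squares -/

/-- The position in the reading order of the cell in row `x.1` and column `x.2`. -/
def cellIndex (x : Fin 4 × Fin 4) : Fin 16 := finProdFinEquiv x

theorem cellIndex_injective : Function.Injective cellIndex :=
  (finProdFinEquiv (m := 4) (n := 4)).injective

theorem cards_cellIndex {n : ℕ} (s : Square n) (x : Fin 4 × Fin 4) :
    s.cards (cellIndex x) = s x.1 x.2 := by
  rw [Square.cards, cellIndex, Equiv.symm_apply_apply]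

/-- The sum of the unit words of four cells. -/
def cellWord (p : Fin 4 → Fin 4 × Fin 4) : Word 16 := ∑ k, Pi.single (cellIndex (p k)) 1

/-- The quadruples of cells that hold quads in the quad squares of a type. -/
def quadCells : SquareType → Set (Fin 4 → Fin 4 × Fin 4)
  | .semimagic => {p | (∃ i, p = fun j => (i, j)) ∨ ∃ j, p = fun i => (i, j)}
  | .magic => {p | ((∃ i, p = fun j => (i, j)) ∨ ∃ j, p = fun i => (i, j)) ∨
      (p = fun i => (i, i)) ∨ p = fun i => (i, i.rev)}
  | .stronglyMagic => {p | Function.Injective p ∧ SameDiffOrHalf (fun m => (p m).1) ∧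
      SameDiffOrHalf (fun m => (p m).2)}

theorem holds_iff (t : SquareType) {n : ℕ} (s : Square n) :
    t.Holds s ↔ Function.Injective s.cards ∧
      ∀ p ∈ quadCells t, IsQuad (fun m => s (p m).1 (p m).2) := by
  cases t
  · refine and_congr_right fun _ => ⟨?_, fun h => ⟨fun i => ?_, fun j => ?_⟩⟩
    · rintro ⟨hr, hc⟩ p (⟨i, rfl⟩ | ⟨j, rfl⟩)
      · exact hr i
      · exact hc j
    · exact h _ (Or.inl ⟨i, rfl⟩)
    · exact h _ (Or.inr ⟨j, rfl⟩)
  · constructor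
    · rintro ⟨⟨hinj, hr, hc⟩, hd, hd'⟩
      refine ⟨hinj, ?_⟩
      rintro p ((⟨i, rfl⟩ | ⟨j, rfl⟩) | (rfl | rfl))
      · exact hr i
      · exact hc j
      · exact hd
      · exact hd'
    · rintro ⟨hinj, h⟩
      exact ⟨⟨hinj, fun i => h _ (Or.inl (Or.inl ⟨i, rfl⟩)),
        fun j => h _ (Or.inl (Or.inr ⟨j, rfl⟩))⟩, h _ (Or.inr (Or.inl rfl)), h _ (Or.inr (Or.inr rfl))⟩
  · exact and_congr_right fun _ => ⟨fun h p hp => h p hp.1 hp.2.1 hp.2.2,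
      fun h p h1 h2 h3 => h p ⟨h1, h2, h3⟩⟩

theorem row_mem_quadCells (t : SquareType) (i : Fin 4) : (fun j => (i, j)) ∈ quadCells t := by
  cases t
  · exact Or.inl ⟨i, rfl⟩
  · exact Or.inl (Or.inl ⟨i, rfl⟩)
  · exact ⟨fun a b h => congrArg Prod.snd h, Or.inl fun _ _ => rfl, Or.inr (Or.inl fun a b h => h)⟩

theorem col_mem_quadCells (t : SquareType) (j : Fin 4) : (fun i => (i, j)) ∈ quadCells t := by
  cases t
  · exact Or.inr ⟨j, rfl⟩
  · exact Or.inl (Or.inr ⟨j, rfl⟩)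
  · exact ⟨fun a b h => congrArg Prod.fst h, Or.inr (Or.inl fun a b h => h), Or.inl fun _ _ => rfl⟩

theorem injective_of_mem_quadCells {t : SquareType} {p : Fin 4 → Fin 4 × Fin 4}
    (hp : p ∈ quadCells t) : Function.Injective p := by
  cases t
  · rcases hp with ⟨i, rfl⟩ | ⟨j, rfl⟩
    · exact fun a b h => congrArg Prod.snd h
    · exact fun a b h => congrArg Prod.fst h
  · rcases hp with (⟨i, rfl⟩ | ⟨j, rfl⟩) | (rfl | rfl)
    · exact fun a b h => congrArg Prod.snd h
    · exact fun a b h => congrArg Prod.fst h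
    · exact fun a b h => congrArg Prod.fst h
    · exact fun a b h => congrArg Prod.fst h
  · exact hp.1

theorem isQuad_iff_cellWord_mem {n : ℕ} {s : Square n} (hs : Function.Injective s.cards)
    {p : Fin 4 → Fin 4 × Fin 4} (hp : Function.Injective p) :
    IsQuad (fun m => s (p m).1 (p m).2) ↔ cellWord p ∈ codeOf s.cards := by
  have h1 : ∑ i, cellWord p i = 0 := by
    simp only [cellWord, Finset.sum_apply]
    rw [Finset.sum_comm]
    simp only [Finset.sum_pi_single', Finset.mem_univ, if_true]
    decide
  have h2 : ∑ i, cellWord p i • s.cards i = ∑ m, s (p m).1 (p m).2 := by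
    simp only [cellWord, Finset.sum_apply, Finset.sum_smul]
    rw [Finset.sum_comm]
    simp [Pi.single_apply, cards_cellIndex]
  rw [mem_codeOf, h2, IsQuad]
  simp only [h1, true_and]
  refine and_iff_right ?_
  intro a b hab
  simp only [← cards_cellIndex] at hab
  exact hp (cellIndex_injective (hs hab))

/-- The codes of the quad squares of a type are the quad codes that contain the words of the cells
required to hold quads. -/
theorem mem_squareCodes_iff {t : SquareType} {C : LinearCode 16} :
    C ∈ squareCodes t ↔ IsQuadCode C ∧ ∀ p ∈ quadCells t, cellWord p ∈ C := by
  constructor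
  · rintro ⟨n, s, hs, hC⟩
    refine ⟨hC.isQuadCode, fun p hp => ?_⟩
    obtain ⟨hinj, hq⟩ := (holds_iff t s).1 hs
    rw [← hC.2]
    exact (isQuad_iff_cellWord_mem hinj (injective_of_mem_quadCells hp)).1 (hq p hp)
  · rintro ⟨hC, h⟩
    obtain ⟨a, ha⟩ := hC.exists_realizes
    have hcards : Square.cards (fun i j => a (cellIndex (i, j))) = a := by
      funext x
      simp [Square.cards, cellIndex]
    rw [← hcards] at ha
    refine ⟨_, _, (holds_iff t _).2 ⟨ha.1, fun p hp => ?_⟩, ha⟩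
    rw [isQuad_iff_cellWord_mem ha.1 (injective_of_mem_quadCells hp), ha.2]
    exact h p hp

/-! ### Syndromes -/

/-- The syndromes of the 16 cells in the reading order. For the cell in row `i` and column `j` write
`x₁, x₂` and `y₁, y₂` for the binary digits of `i` and `j`, lowest digit first. The digits of the
number, from the lowest one, are
`x₁ y₂, x₁ y₂ + x₂ y₁, x₁ y₁, x₂ y₂, x₁, x₂, y₁, y₂, 1`.
The last digit records the parity of a word. The first four are ordered so that the diagonals have
syndrome `1`, and that the strongly magic quadruples generate the numbers below `16`. -/
def cellNumber : Fin 16 → ℕ :=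
  ![256, 320, 384, 448, 272, 340, 403, 471, 288, 354, 424, 490, 304, 374, 443, 509]

/-- The parity checks satisfied by the rows and columns of a square. -/
noncomputable def syndrome : Word 16 →ₗ[ZMod 2] Word 9 :=
  Fintype.linearCombination (ZMod 2) fun i => bits 9 (cellNumber i)

theorem syndrome_single (i : Fin 16) : syndrome (Pi.single i 1) = bits 9 (cellNumber i) := by
  simp [syndrome]

theorem syndrome_apply (c : Word 16) (k : Fin 9) :
    syndrome c k = ∑ i, c i * bits 9 (cellNumber i) k := by
  simp [syndrome, Fintype.linearCombination_apply]

theorem syndrome_parity (c : Word 16) : syndrome c 8 = ∑ i, c i := by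
  have h : ∀ i, bits 9 (cellNumber i) 8 = 1 := by decide
  simp [syndrome_apply, h]

theorem syndrome_cellWord (p : Fin 4 → Fin 4 × Fin 4) :
    syndrome (cellWord p) = bits 9 (cellNumber (cellIndex (p 0)) ^^^ cellNumber (cellIndex (p 1)) ^^^
      cellNumber (cellIndex (p 2)) ^^^ cellNumber (cellIndex (p 3))) := by
  simp only [cellWord, Fin.sum_univ_four, map_add, syndrome_single, bits_xor]

theorem syndrome_surjective : Function.Surjective syndrome := by
  have hmem : ∀ l : List (Fin 16), bits 9 (l.foldr (fun i a => cellNumber i ^^^ a) 0) ∈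
      LinearMap.range syndrome := by
    intro l
    induction l with
    | nil => rw [List.foldr_nil, bits_zero]; exact zero_mem _
    | cons i l ih =>
      rw [List.foldr_cons, bits_xor]
      exact add_mem ⟨_, syndrome_single i⟩ ih
  -- The `k`-th list consists of cells with sum of syndromes `2 ^ k`.
  have h : ∀ k : Fin 9, ((![[0, 5, 10, 15], [0, 1, 8, 9], [0, 1, 4, 5], [0, 2, 8, 10], [0, 4],
      [0, 8], [0, 1], [0, 2], [0]] : Fin 9 → List (Fin 16)) k).foldr
        (fun i a => cellNumber i ^^^ a) 0 = 2 ^ (k : ℕ) := by decide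
  have hle : initial 9 9 ≤ LinearMap.range syndrome :=
    (initial_le_iff le_rfl).2 fun k hk => h ⟨k, hk⟩ ▸ hmem _
  exact fun y => hle fun i hi => absurd i.2 (not_lt.2 hi)

/-- A word with zero syndrome is a sum of rows and columns. The coefficients are chosen to match the
word in the last row and the last column. -/
theorem eq_sum_of_syndrome_eq_zero {c : Word 16} (h : syndrome c = 0) :
    c = ∑ i, (c (cellIndex (i, 3)) + c (cellIndex (3, 3))) • cellWord (fun j => (i, j)) +
      ∑ j, c (cellIndex (3, j)) • cellWord (fun i => (i, j)) := by
  have h' : ∀ k, ∑ i, c i * bits 9 (cellNumber i) k = 0 := fun k => by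
    rw [← syndrome_apply, h, Pi.zero_apply]
  have e : ∀ i j : Fin 4, cellIndex (i, j) = ⟨4 * i + j, by omega⟩ := by decide
  have h0 := h' 0
  have h1 := h' 1
  have h2 := h' 2
  have h3 := h' 3
  have h4 := h' 4
  have h5 := h' 5
  have h6 := h' 6
  have h7 := h' 7
  have h8 := h' 8
  clear h' h
  simp [Fin.sum_univ_succ, bits, cellNumber, Nat.testBit] at h0 h1 h2 h3 h4 h5 h6 h7 h8
  funext p
  fin_cases p <;> simp [Fin.sum_univ_succ, e, cellWord] <;> grind

theorem ker_syndrome_le {t : SquareType} {C : LinearCode 16} (h : ∀ p ∈ quadCells t, cellWord p ∈ C) :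
    LinearMap.ker syndrome ≤ C := by
  intro c hc
  rw [eq_sum_of_syndrome_eq_zero (LinearMap.mem_ker.1 hc)]
  exact add_mem (sum_mem fun i _ => C.smul_mem _ (h _ (row_mem_quadCells t i)))
    (sum_mem fun j _ => C.smul_mem _ (h _ (col_mem_quadCells t j)))

theorem finrank_comap_syndrome (U : LinearCode 9) :
    Module.finrank (ZMod 2) (U.comap syndrome) = Module.finrank (ZMod 2) U + 7 := by
  have h1 := (U.mkQ ∘ₗ syndrome).finrank_range_add_finrank_ker
  have h2 := U.finrank_quotient_add_finrank
  have hker : LinearMap.ker (U.mkQ ∘ₗ syndrome) = U.comap syndrome := by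
    rw [LinearMap.ker_comp, Submodule.ker_mkQ]
  have hrange : LinearMap.range (U.mkQ ∘ₗ syndrome) = ⊤ :=
    LinearMap.range_eq_top.2 (U.mkQ_surjective.comp syndrome_surjective)
  rw [hker, hrange, finrank_top, Module.finrank_fin_fun] at h1
  rw [Module.finrank_fin_fun] at h2
  omega

/-- The mask of the syndromes of even words that are not syndromes of words of weight `2`. -/
def quadMask : ℕ :=
  88307639897345153692411558021417914854158695948527380475418119762002074599423

theorem lt_of_testBit_quadMask {a : ℕ} (h : quadMask.testBit a = true) : a < 2 ^ 8 := by
  by_contra! ha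
  have : quadMask < 2 ^ a := lt_of_lt_of_le (by decide +kernel : quadMask < 2 ^ 2 ^ 8)
    (Nat.pow_le_pow_right (by norm_num) ha)
  rw [Nat.testBit_lt_two_pow this] at h
  exact Bool.false_ne_true h

theorem quadMask_pair : ∀ i j : Fin 16, i ≠ j →
    quadMask.testBit (cellNumber i ^^^ cellNumber j) = false := by
  decide +kernel

/-- The last coordinate of a syndrome is the parity of the word. -/
theorem exists_pair_of_testBit_quadMask : ∀ a : Fin (2 ^ 9), quadMask.testBit a = false →
    bits 9 a 8 = 1 ∨ ∃ i j, i ≠ j ∧ (a : ℕ) = cellNumber i ^^^ cellNumber j := by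
  decide +kernel

theorem isQuadCode_comap_syndrome {U : LinearCode 9} :
    IsQuadCode (U.comap syndrome) ↔ InsideMask quadMask U := by
  have hpair : ∀ i j, syndrome (Pi.single i 1 + Pi.single j 1) =
      bits 9 (cellNumber i ^^^ cellNumber j) := fun i j => by
    rw [map_add, syndrome_single, syndrome_single, bits_xor]
  rw [isQuadCode_iff]
  constructor
  · rintro ⟨heven, h2⟩ a ha haU
    by_contra hmask
    obtain h | ⟨i, j, hij, h⟩ :=
      exists_pair_of_testBit_quadMask ⟨a, ha⟩ (Bool.eq_false_iff.2 hmask)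
    · obtain ⟨c, hc⟩ := syndrome_surjective (bits 9 a)
      have := heven c (by rwa [Submodule.mem_comap, hc])
      rw [← syndrome_parity, hc, h] at this
      exact one_ne_zero this
    · refine h2 i j hij ?_
      rwa [Submodule.mem_comap, hpair, ← h]
  · intro hU
    constructor
    · intro c hc
      rw [← syndrome_parity]
      exact hU.le_initial (fun a => lt_of_testBit_quadMask) hc 8 le_rfl
    · intro i j hij hmem
      rw [Submodule.mem_comap, hpair] at hmem
      have hlt : ∀ i, cellNumber i < 2 ^ 9 := by decide
      have := hU _ (Nat.xor_lt_two_pow (hlt i) (hlt j)) hmem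
      rw [quadMask_pair i j hij] at this
      exact Bool.false_ne_true this

/-- The syndromes of the required quads of a square type span `initial 9 (syndromeRank t)`. -/
def syndromeRank : SquareType → ℕ
  | .semimagic => 0
  | .magic => 1
  | .stronglyMagic => 4

/-- As elements of `ℤ₂²`, four coordinates that are all the same, half and half, or all different sum
to zero. -/
theorem SameDiffOrHalf.eq_xor {v : Fin 4 → Fin 4} (h : SameDiffOrHalf v) :
    v 3 = v 0 ^^^ v 1 ^^^ v 2 := by
  have key : ∀ a b c d : Fin 4, ((∀ i j, ![a, b, c, d] i = ![a, b, c, d] j) ∨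
      Function.Injective ![a, b, c, d] ∨
      ∀ i, (Finset.univ.filter fun j => ![a, b, c, d] j = ![a, b, c, d] i).card = 2) →
      d = a ^^^ b ^^^ c := by decide +kernel
  have hv : v = ![v 0, v 1, v 2, v 3] := by
    ext i; fin_cases i <;> rfl
  rw [hv] at h
  exact key _ _ _ _ h

/-- Four cells whose coordinates sum to zero have a syndrome in `initial 9 4`: the higher digits of
`cellNumber` are affine functions of the coordinates. -/
theorem xor_cellNumber_lt : ∀ a b c a' b' c' : Fin 4,
    cellNumber (cellIndex (a, a')) ^^^ cellNumber (cellIndex (b, b')) ^^^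
      cellNumber (cellIndex (c, c')) ^^^
        cellNumber (cellIndex (a ^^^ b ^^^ c, a' ^^^ b' ^^^ c')) < 2 ^ 4 := by
  decide +kernel

theorem syndrome_mem_iff {t : SquareType} {U : LinearCode 9} :
    (∀ p ∈ quadCells t, syndrome (cellWord p) ∈ U) ↔ initial 9 (syndromeRank t) ≤ U := by
  have hrow : ∀ i : Fin 4, syndrome (cellWord fun j => (i, j)) = 0 := by
    have : ∀ i : Fin 4, cellNumber (cellIndex (i, 0)) ^^^ cellNumber (cellIndex (i, 1)) ^^^
      cellNumber (cellIndex (i, 2)) ^^^ cellNumber (cellIndex (i, 3)) = 0 := by decide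
    intro i
    rw [syndrome_cellWord, this, bits_zero]
  have hcol : ∀ j : Fin 4, syndrome (cellWord fun i => (i, j)) = 0 := by
    have : ∀ j : Fin 4, cellNumber (cellIndex (0, j)) ^^^ cellNumber (cellIndex (1, j)) ^^^
      cellNumber (cellIndex (2, j)) ^^^ cellNumber (cellIndex (3, j)) = 0 := by decide
    intro j
    rw [syndrome_cellWord, this, bits_zero]
  have hdiag : syndrome (cellWord fun i => (i, i)) = bits 9 (2 ^ 0) := by
    rw [syndrome_cellWord]; rfl
  have hanti : syndrome (cellWord fun i => (i, i.rev)) = bits 9 (2 ^ 0) := by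
    rw [syndrome_cellWord]; rfl
  cases t
  · simp only [syndromeRank, initial_zero, bot_le, iff_true]
    rintro p (⟨i, rfl⟩ | ⟨j, rfl⟩)
    · rw [hrow]; exact U.zero_mem
    · rw [hcol]; exact U.zero_mem
  · rw [syndromeRank, initial_le_iff (by norm_num)]
    constructor
    · intro h k hk
      obtain rfl : k = 0 := by omega
      rw [← hdiag]
      exact h _ (Or.inr (Or.inl rfl))
    · intro h
      have h0 := h 0 one_pos
      rintro p ((⟨i, rfl⟩ | ⟨j, rfl⟩) | (rfl | rfl))
      · rw [hrow]; exact U.zero_mem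
      · rw [hcol]; exact U.zero_mem
      · rwa [hdiag]
      · rwa [hanti]
  · rw [syndromeRank]
    constructor
    · intro h
      have key : ∀ k : Fin 4, ∃ p ∈ quadCells .stronglyMagic,
          syndrome (cellWord p) = bits 9 (2 ^ (k : ℕ)) := by
        intro k
        refine ⟨![fun i => (i, i), ![(0, 0), (0, 1), (2, 0), (2, 1)],
          ![(0, 0), (0, 1), (1, 0), (1, 1)], ![(0, 0), (0, 2), (2, 0), (2, 2)]] k, ?_, ?_⟩
        · simp only [quadCells, Set.mem_ofPred_eq, SameDiffOrHalf]
          revert k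
          decide +kernel
        · rw [syndrome_cellWord]
          fin_cases k <;> rfl
      rw [initial_le_iff (by norm_num)]
      intro k hk
      obtain ⟨p, hp, hpk⟩ := key ⟨k, hk⟩
      rw [← hpk]
      exact h p hp
    · rintro h p ⟨-, hr, hc⟩
      refine h ?_
      rw [syndrome_cellWord]
      have h3 : p 3 = ((p 0).1 ^^^ (p 1).1 ^^^ (p 2).1, (p 0).2 ^^^ (p 1).2 ^^^ (p 2).2) :=
        Prod.ext hr.eq_xor hc.eq_xor
      rw [h3]
      exact bits_mem_initial (xor_cellNumber_lt _ _ _ _ _ _)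

/-- The codes of the quad squares of a type are the preimages under the syndrome map of the
subspaces inside the mask that contain the syndromes of the required quads. -/
theorem squareCodes_eq (t : SquareType) :
    squareCodes t = Submodule.comap syndrome '' maskSubspaces quadMask 9 (syndromeRank t) := by
  ext C
  rw [mem_squareCodes_iff]
  constructor
  · rintro ⟨hC, h⟩
    have hCU : (C.map syndrome).comap syndrome = C :=
      Submodule.comap_map_eq_self (ker_syndrome_le h)
    refine ⟨C.map syndrome, ⟨isQuadCode_comap_syndrome.1 (by rwa [hCU]), ?_⟩, hCU⟩
    exact syndrome_mem_iff.1 fun p hp => Submodule.mem_map_of_mem (h p hp)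
  · rintro ⟨U, ⟨hU, hinit⟩, rfl⟩
    exact ⟨isQuadCode_comap_syndrome.2 hU, syndrome_mem_iff.2 hinit⟩

/-! ### The numbers of codes -/

/-- The kernel evaluates the search, with `X = 2 ^ (2 ^ 9 + 1)`. -/
theorem weightedCount_quadMask (t : SquareType) :
    weightedCount quadMask (2 ^ (2 ^ 9 + 1)) (8 - syndromeRank t) (2 ^ syndromeRank t)
      ((2 ^ (2 ^ 9 + 1)) ^ syndromeRank t) (List.range (2 ^ syndromeRank t)) [0] =
      ∑ d : Fin (9 + 1), codeTable t (d + 7) * (2 ^ (2 ^ 9 + 1)) ^ (d : ℕ) := by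
  cases t <;> decide +kernel

theorem codeTable_le (t : SquareType) (k : ℕ) : codeTable t k ≤ 2823 := by
  unfold codeTable
  split <;> norm_num

theorem codeTable_eq_zero (t : SquareType) {k : ℕ} (hk : k < 7 ∨ 11 < k) : codeTable t k = 0 := by
  unfold codeTable
  split <;> first | rfl | omega

theorem ncard_squareCodes (t : SquareType) (k : ℕ) :
    {C | C ∈ squareCodes t ∧ Module.finrank (ZMod 2) C = k}.ncard = codeTable t k := by
  have himage : {C | C ∈ squareCodes t ∧ Module.finrank (ZMod 2) C = k} =
      Submodule.comap syndrome '' {U ∈ maskSubspaces quadMask 9 (syndromeRank t) |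
        Module.finrank (ZMod 2) U + 7 = k} := by
    ext C
    rw [squareCodes_eq]
    constructor
    · rintro ⟨⟨U, hU, rfl⟩, hk⟩
      exact ⟨U, ⟨hU, by rwa [← finrank_comap_syndrome]⟩, rfl⟩
    · rintro ⟨U, ⟨hU, hk⟩, rfl⟩
      exact ⟨⟨U, hU, rfl⟩, by rwa [finrank_comap_syndrome]⟩
  rw [himage, Set.ncard_image_of_injective _
    (Submodule.comap_injective_of_surjective syndrome_surjective)]
  by_cases hk : 7 ≤ k ∧ k ≤ 16
  · obtain ⟨d, rfl⟩ := Nat.exists_eq_add_of_le' hk.1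
    have hr : syndromeRank t ≤ 8 := by cases t <;> decide
    have hinit : ∀ a < 2 ^ syndromeRank t, quadMask.testBit a = true := by
      cases t <;> decide +kernel
    simp only [Nat.add_right_cancel_iff]
    refine ncard_maskSubspaces (fun a => lt_of_testBit_quadMask) (by norm_num) hr hinit
      (fun d => codeTable t (d + 7)) (fun d => ?_) (weightedCount_quadMask t) (by omega)
    exact (codeTable_le t _).trans_lt (by decide +kernel)
  · rw [codeTable_eq_zero t (by omega), Set.ncard_eq_zero]
    refine Set.eq_empty_of_forall_notMem ?_
    rintro U ⟨-, hU⟩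
    have := U.finrank_le
    rw [Module.finrank_fin_fun] at this
    omega

end EvenQuads

theorem mainTheorem5 :
    (∀ (t : EvenQuads.SquareType) (k : ℕ),
      {C : EvenQuads.LinearCode 16 | C ∈ EvenQuads.squareCodes t ∧
        Module.finrank (ZMod 2) C = k}.ncard = EvenQuads.codeTable t k) ∧
    (∀ (t : EvenQuads.SquareType) (C : EvenQuads.LinearCode 16),
      C ∈ EvenQuads.squareCodes t →
        EvenQuads.IsQuadCode C ∧
        IsLeast (EvenQuads.realizingDeckSizes C)
          (2 ^ (15 - Module.finrank (ZMod 2) C))) := by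
  refine ⟨EvenQuads.ncard_squareCodes, fun t C hC => ?_⟩
  have hquad := (EvenQuads.mem_squareCodes_iff.1 hC).1
  exact ⟨hquad, hquad.isLeast_realizingDeckSizes⟩
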